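/- Let $n\ge 1$, let $q(x)=1$ for $|x|<1$ and $q(x)=2$ for $|x|\ge 1$ ($x\in\mathbb R^n$), so that $\underline q=\operatorname{ess\,inf} q=1$ and $\overline q=\operatorname{ess\,sup} q=2$. Let $0<p\le q(x)$ for all $x$ (that is, $0<p\le 1$) and $\beta\in\mathbb R$. For a measurable $\Omega\subseteq\mathbb R^n$, a weight $w$ and a measurable $g\ge 0$ put $$\|g\|_{L_{q(\cdot),w}(\Omega)}=\inf\Big\{\lambda>0:\ \int_\Omega\Big(\frac{g(x)w(x)}{\lambda}\Big)^{q(x)}dx\le 1\Big\},\qquad L_{q(\cdot)}=L_{q(\cdot),1},$$ and for measurable $f>0$ on $\mathbb R^n$ let $$Gf(x)=\exp\Big(\frac1{|B(0,|x|)|}\int_{B(0,|x|)}\ln f(y)\,dy\Big),$$ where $B(0,r)=\{y:|y|<r\}$ and $\exp(-\infty)=0$. Then the inequality $$\|Gf\|_{L_{q(\cdot),|\cdot|^\beta}(\mathbb R^n)}\le C\Big(\int_{\mathbb R^n}f^p(x)\,dx\Big)^{1/p}\quad\text{for all measurable } f>0$$ holds with a finite constant $C$ if and only if $$n\Big(\frac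 sp-1\Big)\le\beta\le n\Big(\frac1p-\frac12\Big)\quad\text{for some } s\in\Big[1,1+\frac p2\Big].$$ In this case the best (smallest) constant $C$ satisfies $$\sup_{1<s\le 1+\frac p2}\frac{e^{s/p}}{\big(e^s+\frac1{s-1}\big)^{1/p}}\,D'(s,p,q)\ \le\ C\ \le\ \Big(\frac p{\underline q}+\frac{\overline q-p}{\overline q}\Big)^{2/p}\inf_{1<s\le 1+\frac p2}e^{\frac{s-1}p}\,D'(s,p,q),$$ where, for every $s\in(1,1+\frac p2]$, $$D'(s,p,q)=|B(0,1)|^{-1/p}\,\sup_{t>0}\,t^{\frac{n(s-1)}p}\,\big\|\,|\cdot|^{\beta-\frac{ns}p}\,\big\|_{L_{q(\cdot)}(\{|x|>t\})}<\infty .$$ -/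

import Mathlib

open MeasureTheory
open scoped ENNReal NNReal

noncomputable section

/-- The quasi-norm of the weighted variable exponent Lebesgue space `L_{q(·), ω}(Ω)`, for
`Ω ⊆ ℝⁿ` and `f` with values in `[0, ∞]`: the infimum of the numbers `0 < l < ∞` such that
`∫_Ω (f(x) ω(x) / l)^{q(x)} dx ≤ 1` (it is `∞` if there is no such `l`). -/
def luxemburgNorm {n : ℕ} (Ω : Set (EuclideanSpace ℝ (Fin n)))
    (q ω : EuclideanSpace ℝ (Fin n) → ℝ) (f : EuclideanSpace ℝ (Fin n) → ℝ≥0∞) : ℝ≥0∞ :=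
  sInf {l : ℝ≥0∞ | 0 < l ∧ l < ∞ ∧ ∫⁻ x in Ω, (f x * ENNReal.ofReal (ω x) / l) ^ q x ≤ 1}

/-- The extended-real integral `∫_S ln f(y) dy`, as the integral of the positive part minus that of
the negative part. It is the usual integral if `ln f` is integrable on `S`; it is `-∞` if only the
positive part is integrable. -/
def logIntegral {n : ℕ} (f : EuclideanSpace ℝ (Fin n) → ℝ)
    (S : Set (EuclideanSpace ℝ (Fin n))) : EReal :=
  ((∫⁻ y in S, ENNReal.ofReal (Real.log (f y)) : ℝ≥0∞) : EReal) -
    ((∫⁻ y in S, ENNReal.ofReal (-Real.log (f y)) : ℝ≥0∞) : EReal)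

/-- The geometric mean operator
`G f (x) = exp (|B(0,|x|)|⁻¹ ∫_{B(0,|x|)} ln f(y) dy)`, where `exp (-∞) = 0`. -/
def geomMeanOp {n : ℕ} (f : EuclideanSpace ℝ (Fin n) → ℝ) (x : EuclideanSpace ℝ (Fin n)) : ℝ≥0∞ :=
  EReal.exp (logIntegral f (Metric.ball 0 ‖x‖) /
    ((volume (Metric.ball (0 : EuclideanSpace ℝ (Fin n)) ‖x‖) : ℝ≥0∞) : EReal))

/-- The exponent `q(x) = 1` for `|x| < 1` and `q(x) = 2` for `|x| ≥ 1`. -/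
def stepExponent (n : ℕ) (x : EuclideanSpace ℝ (Fin n)) : ℝ :=
  if ‖x‖ < 1 then 1 else 2

/-- The inequality `‖G f‖_{L_{q(·), |·|^β}(ℝⁿ)} ≤ C (∫ f^p)^{1/p}` for all positive measurable
functions `f` on `ℝⁿ`. -/
def GeomMeanInequality {n : ℕ} (q : EuclideanSpace ℝ (Fin n) → ℝ) (p β : ℝ) (C : ℝ≥0) : Prop :=
  ∀ f : EuclideanSpace ℝ (Fin n) → ℝ, AEMeasurable f volume → (∀ x, 0 < f x) →
    luxemburgNorm Set.univ q (fun x => ‖x‖ ^ β) (geomMeanOp f) ≤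
      C * (∫⁻ x, ENNReal.ofReal (f x) ^ p) ^ (1 / p)

/-- The best constant in the inequality: the infimum of all admissible finite constants
(`∞` if there is none). -/
def bestGeomMeanConstant {n : ℕ} (q : EuclideanSpace ℝ (Fin n) → ℝ) (p β : ℝ) : ℝ≥0∞ :=
  ⨅ (C : ℝ≥0) (_ : GeomMeanInequality q p β C), (C : ℝ≥0∞)

/-- `D'(s,p,q) = |B(0,1)|^{-1/p} sup_{t>0} t^{n(s-1)/p} ‖ |·|^{β - ns/p} ‖_{L_{q(·)}(|·| > t)}`. -/
def dPrime {n : ℕ} (q : EuclideanSpace ℝ (Fin n) → ℝ) (β s p : ℝ) : ℝ≥0∞ :=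
  volume (Metric.ball (0 : EuclideanSpace ℝ (Fin n)) 1) ^ (-1 / p) *
    ⨆ (t : ℝ) (_ : 0 < t), ENNReal.ofReal (t ^ (n * (s - 1) / p)) *
      luxemburgNorm {x | t < ‖x‖} q (fun _ => 1)
        (fun x => ENNReal.ofReal (‖x‖ ^ (β - n * s / p)))

end

/-! Everything rests on one exact value: the mean of `log ‖y‖` over the ball of radius `R` is `log R
- 1 / n`.

Lower bound: `testFun` with parameter `t` is normalised so that its geometric mean at `‖x‖ > t` is
exactly `t ^ (n(s-1)/p) * ‖x‖ ^ (-ns/p)`, while the integral of its `p`-th power does not depend on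
`t`. Inserting it in the inequality and taking the supremum over `t` bounds `C` below by a constant
times `dPrime`; in particular `dPrime` is finite.

Upper bound: Jensen's inequality applied to `f ^ p * ‖y‖ ^ (n(s-1))` bounds `(G f) ^ p` by a
weighted Hardy average of `f ^ p` (`geomMeanOp_rpow_le`). After normalisation, `f ^ p dy` is a
probability measure, so Jensen for the power `q(x) / p ≥ 1` and Tonelli reduce the modular of `G f`
to tail modulars over `‖x‖ > ‖y‖`, each at most `1` by the definition of `dPrime`. This gives the
constant `e ^ ((s-1)/p) * dPrime`; the extra factor in the theorem is at least `1`.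

Range of `β`: for the step exponent and `s > 1`, `dPrime` is finite exactly when `n(1/p - 1) ≤ β ≤
n(1/p - 1/2)`, whatever `s` is. The lower endpoint comes from small `t`, where `q = 1`, and the
upper one from large `t`, where `q = 2`. -/

section Balls
variable {n : ℕ}

theorem measurableSet_lt_norm (t : ℝ) : MeasurableSet {x : EuclideanSpace ℝ (Fin n) | t < ‖x‖} :=
  measurableSet_lt measurable_const measurable_norm

theorem volume_real_unitBall_pos :
    0 < volume.real (Metric.ball (0 : EuclideanSpace ℝ (Fin n)) 1) :=
  ENNReal.toReal_pos (Metric.measure_ball_pos _ _ one_pos).ne' measure_ball_lt_top.ne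

end Balls

/-! ### Radial integrals of the logarithm and of powers. -/

section Radial
variable {n : ℕ} [NeZero n]

theorem intervalIntegrable_pow_mul_log (k : ℕ) (a b : ℝ) :
    IntervalIntegrable (fun r : ℝ => r ^ k * Real.log r) volume a b :=
  intervalIntegral.intervalIntegrable_log'.continuousOn_mul (by fun_prop)

theorem integrableOn_log_norm_ball {R : ℝ} (hR : 0 < R) :
    IntegrableOn (fun y : EuclideanSpace ℝ (Fin n) => Real.log ‖y‖) (Metric.ball 0 R) := by
  rw [integrableOn_fun_norm_addHaar volume (f := Real.log)]
  exact ((intervalIntegrable_pow_mul_log _ 0 R).1).mono_set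
    (by rw [← Set.Ioo_union_right hR]; exact Set.subset_union_left)

theorem integral_pow_mul_log {m : ℕ} (hm : m ≠ 0) {R : ℝ} (hR : 0 < R) :
    ∫ r in (0 : ℝ)..R, r ^ (m - 1) * Real.log r = R ^ m * (Real.log R - 1 / m) / m := by
  obtain ⟨k, rfl⟩ := Nat.exists_eq_succ_of_ne_zero hm
  have hk : ((k : ℝ) + 1) ≠ 0 := by positivity
  -- The antiderivative is written through `r * log r`, which is continuous at `0`, so the
  -- fundamental theorem applies on the closed interval although `log` is singular there.
  have hcont : Continuous fun r : ℝ =>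
      (r ^ k * (r * Real.log r) - r ^ (k + 1) / (k + 1)) / (k + 1) := by
    have := Real.continuous_mul_log
    fun_prop
  have h := intervalIntegral.integral_eq_sub_of_hasDerivAt_of_le
    (f := fun r : ℝ => (r ^ k * (r * Real.log r) - r ^ (k + 1) / (k + 1)) / (k + 1))
    (f' := fun r : ℝ => r ^ k * Real.log r) hR.le hcont.continuousOn (fun r hr => ?_)
    (intervalIntegrable_pow_mul_log k 0 R)
  · simp only [Nat.succ_eq_add_one, Nat.add_sub_cancel]
    rw [h]
    push_cast
    simp
    field_simp
    ring
  · have hr0 : r ≠ 0 := hr.1.ne'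
    have h1 : HasDerivAt (fun r : ℝ => (r ^ (k + 1) * Real.log r - r ^ (k + 1) / (k + 1)) / (k + 1))
        (r ^ k * Real.log r) r := by
      have h2 := hasDerivAt_pow (k + 1) r
      have h3 := ((h2.mul (Real.hasDerivAt_log hr0)).sub (h2.div_const ((k : ℝ) + 1))).div_const
        ((k : ℝ) + 1)
      convert! h3 using 1
      push_cast
      field_simp
      ring
    convert! h1 using 4
    ring

/-- The term `-1 / n` is the source of the exponential factors in both bounds for the best constant.
-/
theorem setIntegral_log_norm_ball {R : ℝ} (hR : 0 < R) :
    ∫ y in Metric.ball (0 : EuclideanSpace ℝ (Fin n)) R, Real.log ‖y‖ =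
      volume.real (Metric.ball (0 : EuclideanSpace ℝ (Fin n)) 1) *
        (R ^ n * (Real.log R - 1 / n)) := by
  have hn : (n : ℝ) ≠ 0 := Nat.cast_ne_zero.2 (NeZero.ne n)
  rw [← integral_indicator measurableSet_ball]
  have h1 : (Metric.ball (0 : EuclideanSpace ℝ (Fin n)) R).indicator (fun y => Real.log ‖y‖) =
      fun y => (Set.Iio R).indicator Real.log ‖y‖ := by
    ext y; simp [Set.indicator]
  rw [h1, integral_fun_norm_addHaar]
  have h2 : ∫ y in Set.Ioi (0 : ℝ), y ^ (n - 1) • (Set.Iio R).indicator Real.log y =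
      ∫ r in (0 : ℝ)..R, r ^ (n - 1) * Real.log r := by
    rw [intervalIntegral.integral_of_le hR.le, integral_Ioc_eq_integral_Ioo,
      ← Set.Ioi_inter_Iio, ← setIntegral_indicator measurableSet_Iio]
    congr 1; ext y
    by_cases hy : y < R <;> simp [hy]
  simp only [finrank_euclideanSpace, Fintype.card_fin]
  rw [h2, integral_pow_mul_log (NeZero.ne n) hR]
  simp only [nsmul_eq_mul, smul_eq_mul]
  field_simp

theorem lintegral_norm_rpow_tail {t σ : ℝ} (ht : 0 < t) (hσ : 0 < σ) :
    ∫⁻ x in {x : EuclideanSpace ℝ (Fin n) | t < ‖x‖}, ENNReal.ofReal (‖x‖ ^ (-n - σ)) =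
      ENNReal.ofReal (volume.real (Metric.ball (0 : EuclideanSpace ℝ (Fin n)) 1) *
        (n * t ^ (-σ) / σ)) := by
  have hn : n ≠ 0 := NeZero.ne n
  have h1 : {x : EuclideanSpace ℝ (Fin n) | t < ‖x‖}.indicator (fun y => ‖y‖ ^ (-n - σ)) =
      fun y => (Set.Ioi t).indicator (fun r : ℝ => r ^ (-n - σ)) ‖y‖ := by
    ext y; simp [Set.indicator]
  have hpow : ∀ y ∈ Set.Ioi (0 : ℝ), y ^ (n - 1) • (Set.Ioi t).indicator (fun r : ℝ => r ^ (-n - σ)) y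
      = (Set.Ioi t).indicator (fun r : ℝ => r ^ (-1 - σ)) y := by
    intro y hy
    by_cases h : t < y
    · simp only [Set.mem_Ioi, h, Set.indicator_of_mem, smul_eq_mul]
      rw [← Real.rpow_natCast, ← Real.rpow_add hy, Nat.cast_sub (by omega)]
      congr 1; push_cast; ring
    · simp [h]
  have hsub : Set.Ioi t ⊆ Set.Ioi (0 : ℝ) := Set.Ioi_subset_Ioi ht.le
  have hint : Integrable (fun y : EuclideanSpace ℝ (Fin n) =>
      (Set.Ioi t).indicator (fun r : ℝ => r ^ (-n - σ)) ‖y‖) := by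
    rw [integrable_fun_norm_addHaar]
    simp only [finrank_euclideanSpace, Fintype.card_fin]
    rw [integrableOn_congr_fun hpow measurableSet_Ioi, IntegrableOn,
      integrable_indicator_iff measurableSet_Ioi, IntegrableOn,
      Measure.restrict_restrict measurableSet_Ioi, Set.inter_eq_left.2 hsub]
    exact integrableOn_Ioi_rpow_of_lt (by linarith) ht
  rw [← ofReal_integral_eq_lintegral_ofReal]
  · congr 1
    rw [← integral_indicator (measurableSet_lt_norm t), h1, integral_fun_norm_addHaar]
    simp only [finrank_euclideanSpace, Fintype.card_fin]
    rw [setIntegral_congr_fun measurableSet_Ioi hpow, setIntegral_indicator measurableSet_Ioi,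
      Set.inter_eq_right.2 hsub, integral_Ioi_rpow_of_lt (by linarith) ht]
    simp only [nsmul_eq_mul, smul_eq_mul]
    rw [show -1 - σ + 1 = -σ by ring]
    field_simp
  · rw [← IntegrableOn, ← integrable_indicator_iff (measurableSet_lt_norm t), h1]
    exact hint
  · exact Filter.Eventually.of_forall fun x => by positivity

theorem volume_real_ball {R : ℝ} (hR : 0 < R) :
    volume.real (Metric.ball (0 : EuclideanSpace ℝ (Fin n)) R) =
      volume.real (Metric.ball (0 : EuclideanSpace ℝ (Fin n)) 1) * R ^ n := by
  rw [measureReal_def, Measure.addHaar_ball _ _ hR.le, ENNReal.toReal_mul,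
    ENNReal.toReal_ofReal (by positivity), finrank_euclideanSpace, Fintype.card_fin, mul_comm]
  rfl

end Radial

/-! ### The geometric mean when `log f` is integrable. -/

section GeometricMean
variable {n : ℕ}

theorem logIntegral_eq_coe_integral {f : EuclideanSpace ℝ (Fin n) → ℝ}
    {S : Set (EuclideanSpace ℝ (Fin n))} (hf : IntegrableOn (fun y => Real.log (f y)) S) :
    logIntegral f S = ((∫ y in S, Real.log (f y) : ℝ) : EReal) := by
  have h1 : ∫⁻ y in S, ENNReal.ofReal (Real.log (f y)) ≠ ∞ := hf.lintegral_lt_top.ne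
  have h2 : ∫⁻ y in S, ENNReal.ofReal (-Real.log (f y)) ≠ ∞ := hf.neg.lintegral_lt_top.ne
  rw [logIntegral, integral_eq_lintegral_pos_part_sub_lintegral_neg_part hf, EReal.coe_sub,
    EReal.coe_ennreal_toReal h1, EReal.coe_ennreal_toReal h2]

theorem geomMeanOp_eq_ofReal_exp {f : EuclideanSpace ℝ (Fin n) → ℝ}
    {x : EuclideanSpace ℝ (Fin n)}
    (hf : IntegrableOn (fun y => Real.log (f y)) (Metric.ball 0 ‖x‖)) :
    geomMeanOp f x = ENNReal.ofReal (Real.exp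
      ((∫ y in Metric.ball 0 ‖x‖, Real.log (f y)) /
        volume.real (Metric.ball (0 : EuclideanSpace ℝ (Fin n)) ‖x‖))) := by
  rw [geomMeanOp, logIntegral_eq_coe_integral hf, measureReal_def,
    ← EReal.coe_ennreal_toReal measure_ball_lt_top.ne, ← EReal.coe_div, EReal.exp_coe]

end GeometricMean

theorem volume_unitBall_eq_ofReal (n : ℕ) :
    volume (Metric.ball (0 : EuclideanSpace ℝ (Fin n)) 1) =
      ENNReal.ofReal (volume.real (Metric.ball (0 : EuclideanSpace ℝ (Fin n)) 1)) :=
  (ENNReal.ofReal_toReal measure_ball_lt_top.ne).symm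

/-- The extremal function: constant on the ball of radius `t`, a power of the norm outside. -/
noncomputable def testFun (n : ℕ) (p s t : ℝ) (y : EuclideanSpace ℝ (Fin n)) : ℝ :=
  if ‖y‖ < t then t ^ (-(n : ℝ) / p)
  else Real.exp (-s / p) * t ^ (n * (s - 1) / p) * ‖y‖ ^ (-(n * s / p))

/-! ### The extremal family and the lower bound. -/

section TestFun
variable {n : ℕ} {p s t : ℝ}

theorem testFun_pos (ht : 0 < t) (y : EuclideanSpace ℝ (Fin n)) : 0 < testFun n p s t y := by
  unfold testFun
  split_ifs with h
  · positivity
  · have : 0 < ‖y‖ := ht.trans_le (not_lt.1 h)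
    positivity

theorem measurable_testFun : Measurable (testFun n p s t) := by
  unfold testFun
  exact Measurable.ite (measurableSet_lt measurable_norm measurable_const) (by fun_prop)
    (by fun_prop)

/-- Extending the outer formula to all of space and correcting it on the ball of radius `t` leaves
only integrals of constants and of `log ‖y‖` over balls. -/
theorem log_testFun (ht : 0 < t) (y : EuclideanSpace ℝ (Fin n)) :
    Real.log (testFun n p s t y) =
      (-s / p + n * (s - 1) / p * Real.log t - n * s / p * Real.log ‖y‖) +
      (Metric.ball (0 : EuclideanSpace ℝ (Fin n)) t).indicator
        (fun y => (s / p - n * s / p * Real.log t) + n * s / p * Real.log ‖y‖) y := by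
  unfold testFun
  by_cases h : ‖y‖ < t
  · have : y ∈ Metric.ball (0 : EuclideanSpace ℝ (Fin n)) t := by simpa using h
    rw [if_pos h, Set.indicator_of_mem this, Real.log_rpow ht]
    ring
  · have h' : y ∉ Metric.ball (0 : EuclideanSpace ℝ (Fin n)) t := by simpa using h
    have h0 : 0 < ‖y‖ := ht.trans_le (not_lt.1 h)
    rw [if_neg h, Set.indicator_of_notMem h', Real.log_mul (by positivity) (by positivity),
      Real.log_mul (by positivity) (by positivity), Real.log_exp, Real.log_rpow ht,
      Real.log_rpow h0]
    ring

/-- The factor `exp (-s / p)` in `testFun` cancels the `-1 / n` in the mean of `log ‖y‖`, and makes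
the correction on the inner ball integrate to zero. -/
theorem geomMeanOp_testFun [NeZero n] (ht : 0 < t) {x : EuclideanSpace ℝ (Fin n)}
    (hx : t < ‖x‖) :
    geomMeanOp (testFun n p s t) x =
      ENNReal.ofReal (t ^ (n * (s - 1) / p) * ‖x‖ ^ (-(n * s / p))) := by
  have hR : 0 < ‖x‖ := ht.trans hx
  have hV := volume_real_unitBall_pos (n := n)
  have hn : (n : ℝ) ≠ 0 := Nat.cast_ne_zero.2 (NeZero.ne n)
  have hc : ∀ (c R : ℝ), IntegrableOn (fun _ : EuclideanSpace ℝ (Fin n) => c) (Metric.ball 0 R) :=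
    fun c R => integrableOn_const measure_ball_lt_top.ne
  have hl : ∀ (c R : ℝ), 0 < R → IntegrableOn
      (fun y : EuclideanSpace ℝ (Fin n) => c * Real.log ‖y‖) (Metric.ball 0 R) :=
    fun c R hR => (integrableOn_log_norm_ball hR).const_mul c
  have hsub : Metric.ball (0 : EuclideanSpace ℝ (Fin n)) t ⊆ Metric.ball 0 ‖x‖ :=
    Metric.ball_subset_ball hx.le
  have i1 : IntegrableOn (fun y : EuclideanSpace ℝ (Fin n) =>
      -s / p + n * (s - 1) / p * Real.log t - n * s / p * Real.log ‖y‖) (Metric.ball 0 ‖x‖) :=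
    (hc _ _).sub (hl _ _ hR)
  have i2 : IntegrableOn (fun y : EuclideanSpace ℝ (Fin n) =>
      (s / p - n * s / p * Real.log t) + n * s / p * Real.log ‖y‖) (Metric.ball 0 t) :=
    (hc _ _).add (hl _ _ ht)
  have i3 : IntegrableOn ((Metric.ball (0 : EuclideanSpace ℝ (Fin n)) t).indicator
      fun y => (s / p - n * s / p * Real.log t) + n * s / p * Real.log ‖y‖)
      (Metric.ball 0 ‖x‖) :=
    (i2.integrable_indicator measurableSet_ball).integrableOn
  have hlog : (fun y => Real.log (testFun n p s t y)) = fun y =>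
      (-s / p + n * (s - 1) / p * Real.log t - n * s / p * Real.log ‖y‖) +
      (Metric.ball (0 : EuclideanSpace ℝ (Fin n)) t).indicator
        (fun y => (s / p - n * s / p * Real.log t) + n * s / p * Real.log ‖y‖) y :=
    funext fun y => log_testFun ht y
  have hint : IntegrableOn (fun y => Real.log (testFun n p s t y)) (Metric.ball 0 ‖x‖) := by
    rw [hlog]; exact i1.add i3
  rw [geomMeanOp_eq_ofReal_exp hint, hlog, integral_add i1 i3,
    setIntegral_indicator measurableSet_ball, Set.inter_eq_right.2 hsub,
    integral_sub (hc _ _) (hl _ _ hR), integral_add (hc _ _) (hl _ _ ht), integral_const_mul,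
    integral_const_mul, setIntegral_const, setIntegral_const, setIntegral_log_norm_ball hR,
    setIntegral_log_norm_ball ht, volume_real_ball hR, volume_real_ball ht]
  congr 1
  rw [Real.rpow_def_of_pos ht, Real.rpow_def_of_pos hR, ← Real.exp_add]
  congr 1
  simp only [smul_eq_mul]
  by_cases hp : p = 0
  · simp [hp]
  field_simp
  ring

theorem lintegral_testFun_rpow [NeZero n] (hp : 0 < p) (hs : 1 < s) (ht : 0 < t) :
    ∫⁻ y, ENNReal.ofReal (testFun n p s t y) ^ p =
      ENNReal.ofReal (volume.real (Metric.ball (0 : EuclideanSpace ℝ (Fin n)) 1) *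
        (1 + Real.exp (-s) / (s - 1))) := by
  have hV := volume_real_unitBall_pos (n := n)
  have hn : (0 : ℝ) < n := Nat.cast_pos.2 (NeZero.pos n)
  have hs' : 0 < s - 1 := by linarith
  rw [← lintegral_add_compl _ (measurableSet_ball (x := (0 : EuclideanSpace ℝ (Fin n))) (ε := t)),
    mul_add, ENNReal.ofReal_add (by positivity) (by positivity)]
  congr 1
  · have : ∀ y ∈ Metric.ball (0 : EuclideanSpace ℝ (Fin n)) t,
        ENNReal.ofReal (testFun n p s t y) ^ p = ENNReal.ofReal (t ^ (-(n : ℝ))) := by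
      intro y hy
      rw [testFun, if_pos (by simpa using hy), ENNReal.ofReal_rpow_of_nonneg (by positivity) hp.le,
        ← Real.rpow_mul ht.le]
      congr 2; field_simp
    rw [setLIntegral_congr_fun measurableSet_ball this, setLIntegral_const,
      ← ENNReal.ofReal_toReal (measure_ball_lt_top (μ := volume) (x := (0 : EuclideanSpace ℝ (Fin n)))
        (r := t)).ne, ← measureReal_def, volume_real_ball ht, ← ENNReal.ofReal_mul (by positivity),
      Real.rpow_neg ht.le, Real.rpow_natCast]
    congr 1; field_simp
  -- The complement of the ball and the open tail differ by a sphere, which is null.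
  · have hae : (Metric.ball (0 : EuclideanSpace ℝ (Fin n)) t)ᶜ =ᵐ[volume]
        {x : EuclideanSpace ℝ (Fin n) | t < ‖x‖} := by
      have h0 := Measure.addHaar_sphere (volume : Measure (EuclideanSpace ℝ (Fin n))) 0 t
      filter_upwards [compl_mem_ae_iff.2 h0] with x hx
      have hx' : ‖x‖ ≠ t := by simpa using hx
      refine propext ?_
      change x ∉ Metric.ball 0 t ↔ t < ‖x‖
      simpa using ⟨fun h => lt_of_le_of_ne h hx'.symm, le_of_lt⟩
    have : ∀ y ∈ {x : EuclideanSpace ℝ (Fin n) | t < ‖x‖},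
        ENNReal.ofReal (testFun n p s t y) ^ p =
          ENNReal.ofReal (Real.exp (-s) * t ^ (n * (s - 1))) *
            ENNReal.ofReal (‖y‖ ^ (-n - n * (s - 1))) := by
      intro y hy
      have hy' : t < ‖y‖ := hy
      have h0 : 0 < ‖y‖ := ht.trans hy'
      rw [testFun, if_neg (not_lt.2 hy'.le), ENNReal.ofReal_rpow_of_nonneg (by positivity) hp.le,
        ← ENNReal.ofReal_mul (by positivity), Real.mul_rpow (by positivity) (by positivity),
        Real.mul_rpow (by positivity) (by positivity), ← Real.rpow_mul ht.le,
        ← Real.rpow_mul h0.le, ← Real.exp_mul]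
      congr 4
      · field_simp
      · field_simp
      · field_simp; ring
    refine (setLIntegral_congr hae).trans ?_
    rw [setLIntegral_congr_fun (measurableSet_lt_norm t) this,
      lintegral_const_mul _ (by fun_prop), lintegral_norm_rpow_tail ht (by positivity),
      ← ENNReal.ofReal_mul (by positivity), Real.rpow_neg ht.le]
    congr 1
    have : t ^ ((n : ℝ) * (s - 1)) ≠ 0 := by positivity
    field_simp

variable {q : EuclideanSpace ℝ (Fin n) → ℝ} {β : ℝ} {C : ℝ≥0}

theorem GeomMeanInequality.mul_luxemburgNorm_tail_le [NeZero n] (h : GeomMeanInequality q p β C)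
    (hp : 0 < p) (hs : 1 < s) (ht : 0 < t) :
    ENNReal.ofReal (t ^ (n * (s - 1) / p)) * luxemburgNorm {x | t < ‖x‖} q (fun _ => 1)
        (fun x => ENNReal.ofReal (‖x‖ ^ (β - n * s / p))) ≤
      C * ENNReal.ofReal (volume.real (Metric.ball (0 : EuclideanSpace ℝ (Fin n)) 1) *
        (1 + Real.exp (-s) / (s - 1))) ^ (1 / p) := by
  rw [← lintegral_testFun_rpow hp hs ht]
  refine le_trans ?_ (h _ measurable_testFun.aemeasurable (testFun_pos ht))
  refine le_sInf fun l hl => ?_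
  obtain ⟨hl0, hl1, hl2⟩ := hl
  set T := ENNReal.ofReal (t ^ (n * (s - 1) / p)) with hT
  have hT0 : T ≠ 0 := by rw [hT]; simp; positivity
  have hT1 : T ≠ ∞ := ENNReal.ofReal_ne_top
  -- If `l` is admissible for `G f` on the whole space, then `l / T` is admissible for the power on
  -- the tail, because there `G f` is `T` times a power.
  rw [mul_comm, ← ENNReal.le_div_iff_mul_le (Or.inl hT0) (Or.inl hT1)]
  refine sInf_le ⟨ENNReal.div_pos hl0.ne' hT1, ENNReal.div_lt_top hl1.ne hT0, ?_⟩
  refine le_trans (le_of_eq ?_) ((lintegral_mono_set (Set.subset_univ {x | t < ‖x‖})).trans hl2)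
  refine setLIntegral_congr_fun (measurableSet_lt_norm t) fun x hx => ?_
  have hx' : t < ‖x‖ := hx
  have h0 : 0 < ‖x‖ := ht.trans hx'
  simp only
  congr 1
  rw [geomMeanOp_testFun ht hx', ENNReal.ofReal_one, mul_one, ENNReal.div_eq_inv_mul,
    ENNReal.inv_div (Or.inl hT1) (Or.inl hT0), ENNReal.div_eq_inv_mul, ENNReal.div_eq_inv_mul, hT,
    mul_assoc, ← ENNReal.ofReal_mul (by positivity), ← ENNReal.ofReal_mul (by positivity)]
  congr 2
  rw [mul_assoc, ← Real.rpow_add h0]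
  congr 2; ring

theorem GeomMeanInequality.mul_dPrime_le [NeZero n] (h : GeomMeanInequality q p β C)
    (hp : 0 < p) (hs : 1 < s) :
    ENNReal.ofReal (Real.exp (s / p) / (Real.exp s + 1 / (s - 1)) ^ (1 / p)) *
      dPrime q β s p ≤ C := by
  have hV := volume_real_unitBall_pos (n := n)
  have hs' : 0 < s - 1 := by linarith
  have key := iSup₂_le fun t ht => h.mul_luxemburgNorm_tail_le hp hs (t := t) ht
  rw [dPrime]
  refine (mul_le_mul_right (mul_le_mul_right key _) _).trans (le_of_eq ?_)
  rw [volume_unitBall_eq_ofReal, ENNReal.ofReal_rpow_of_pos hV,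
    ENNReal.ofReal_rpow_of_nonneg (by positivity) (by positivity), mul_left_comm (ENNReal.ofReal _) (C : ℝ≥0∞),
    mul_left_comm (ENNReal.ofReal _) (C : ℝ≥0∞), ← ENNReal.ofReal_mul (by positivity),
    ← ENNReal.ofReal_mul (by positivity)]
  convert mul_one (C : ℝ≥0∞)
  rw [← ENNReal.ofReal_one]
  congr 1
  -- This shows that the stated prefactor is `(1 + e ^ (-s) / (s - 1)) ^ (-1/p)`, the reciprocal of
  -- the constant coming from `testFun`.
  have e1 : Real.exp s + 1 / (s - 1) = Real.exp s * (1 + Real.exp (-s) / (s - 1)) := by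
    rw [Real.exp_neg]
    field_simp
  rw [e1, Real.mul_rpow (by positivity) (by positivity), Real.mul_rpow (by positivity) (by positivity),
    ← Real.exp_mul, show -1 / p = -(1 / p) by ring, Real.rpow_neg hV.le, mul_one_div]
  have h1 : (1 + Real.exp (-s) / (s - 1)) ^ (1 / p) ≠ 0 := by positivity
  have h2 : volume.real (Metric.ball (0 : EuclideanSpace ℝ (Fin n)) 1) ^ (1 / p) ≠ 0 := by positivity
  field_simp

theorem GeomMeanInequality.dPrime_lt_top [NeZero n] (h : GeomMeanInequality q p β C)
    (hp : 0 < p) (hs : 1 < s) : dPrime q β s p < ∞ := by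
  have hs' : 0 < s - 1 := by linarith
  have h1 := (h.mul_dPrime_le hp hs).trans_lt ENNReal.coe_lt_top
  by_contra h2
  rw [not_lt_top_iff.1 h2, ENNReal.mul_top] at h1
  · exact lt_irrefl _ h1
  · simp; positivity

end TestFun

/-! ### From `dPrime` to tail modulars and back. -/

section Luxemburg
variable {n : ℕ}

/-- The modular decreases in `l`. The strict inequality supplies an admissible number below `l`, so
attainment of the infimum is never needed. -/
theorem lintegral_le_one_of_luxemburgNorm_lt {Ω : Set (EuclideanSpace ℝ (Fin n))}
    {q ω : EuclideanSpace ℝ (Fin n) → ℝ} (hq : ∀ x, 0 ≤ q x)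
    {f : EuclideanSpace ℝ (Fin n) → ℝ≥0∞} {l : ℝ≥0∞} (h : luxemburgNorm Ω q ω f < l) :
    ∫⁻ x in Ω, (f x * ENNReal.ofReal (ω x) / l) ^ q x ≤ 1 := by
  obtain ⟨l', ⟨-, -, hl'⟩, hlt⟩ := sInf_lt_iff.1 h
  refine le_trans (lintegral_mono fun x => ?_) hl'
  exact ENNReal.rpow_le_rpow (ENNReal.div_le_div_left hlt.le _) (hq x)

variable {q : EuclideanSpace ℝ (Fin n) → ℝ} {β s p : ℝ}

theorem ofReal_rpow_mul_div {t σ a : ℝ} (ht : 0 < t) {L : ℝ≥0∞} (x : EuclideanSpace ℝ (Fin n)) :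
    ENNReal.ofReal (‖x‖ ^ a) * ENNReal.ofReal 1 / (L / ENNReal.ofReal (t ^ σ)) =
      ENNReal.ofReal (t ^ σ * ‖x‖ ^ a) / L := by
  have hT0 : ENNReal.ofReal (t ^ σ) ≠ 0 := by simp; positivity
  have hT1 : ENNReal.ofReal (t ^ σ) ≠ ∞ := ENNReal.ofReal_ne_top
  rw [ENNReal.ofReal_one, mul_one, ENNReal.div_eq_inv_mul,
    ENNReal.inv_div (Or.inl hT1) (Or.inl hT0), ENNReal.div_eq_inv_mul, ENNReal.div_eq_inv_mul,
    mul_assoc, ← ENNReal.ofReal_mul (by positivity)]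

theorem volume_unitBall_rpow_ne_zero (r : ℝ) :
    volume (Metric.ball (0 : EuclideanSpace ℝ (Fin n)) 1) ^ r ≠ 0 := by
  have hV := volume_real_unitBall_pos (n := n)
  rw [volume_unitBall_eq_ofReal, ENNReal.ofReal_rpow_of_pos hV]
  simp; positivity

theorem volume_unitBall_rpow_ne_top (r : ℝ) :
    volume (Metric.ball (0 : EuclideanSpace ℝ (Fin n)) 1) ^ r ≠ ∞ := by
  rw [volume_unitBall_eq_ofReal, ENNReal.ofReal_rpow_of_pos volume_real_unitBall_pos]
  exact ENNReal.ofReal_ne_top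

theorem lintegral_tail_le_one_of_dPrime_lt (hq : ∀ x, 0 ≤ q x) {D : ℝ≥0∞}
    (h : dPrime q β s p < D) {t : ℝ} (ht : 0 < t) :
    ∫⁻ x in {x | t < ‖x‖}, (ENNReal.ofReal (t ^ (n * (s - 1) / p) * ‖x‖ ^ (β - n * s / p)) /
      (volume (Metric.ball (0 : EuclideanSpace ℝ (Fin n)) 1) ^ (1 / p) * D)) ^ q x ≤ 1 := by
  set V := volume (Metric.ball (0 : EuclideanSpace ℝ (Fin n)) 1) with hV
  set T := ENNReal.ofReal (t ^ (n * (s - 1) / p)) with hT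
  have hT0 : T ≠ 0 := by rw [hT]; simp; positivity
  have hT1 : T ≠ ∞ := ENNReal.ofReal_ne_top
  have key : luxemburgNorm {x | t < ‖x‖} q (fun _ => 1)
        (fun x => ENNReal.ofReal (‖x‖ ^ (β - n * s / p))) < V ^ (1 / p) * D / T := by
    rw [ENNReal.lt_div_iff_mul_lt (Or.inl hT0) (Or.inl hT1), mul_comm]
    refine lt_of_eq_of_lt (one_mul _).symm ?_
    rw [← ENNReal.mul_inv_cancel (volume_unitBall_rpow_ne_zero (n := n) (1 / p))
      (volume_unitBall_rpow_ne_top _), mul_assoc, ← ENNReal.rpow_neg, ← neg_div]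
    refine ENNReal.mul_right_strictMono (volume_unitBall_rpow_ne_zero _)
      (volume_unitBall_rpow_ne_top _) (lt_of_le_of_lt ?_ h)
    exact mul_le_mul_right (le_iSup₂ (f := fun (t : ℝ) (_ : 0 < t) =>
      ENNReal.ofReal (t ^ (n * (s - 1) / p)) * luxemburgNorm {x | t < ‖x‖} q (fun _ => 1)
        (fun x => ENNReal.ofReal (‖x‖ ^ (β - n * s / p)))) t ht) _
  have := lintegral_le_one_of_luxemburgNorm_lt hq key
  simpa only [hT, ofReal_rpow_mul_div ht] using this

theorem dPrime_lt_top_of_lintegral_tail_le_one {L : ℝ≥0∞} (hL0 : L ≠ 0) (hL1 : L ≠ ∞)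
    (h : ∀ t : ℝ, 0 < t → ∫⁻ x in {x : EuclideanSpace ℝ (Fin n) | t < ‖x‖},
      (ENNReal.ofReal (t ^ (n * (s - 1) / p) * ‖x‖ ^ (β - n * s / p)) / L) ^ q x ≤ 1) :
    dPrime q β s p < ∞ := by
  refine ENNReal.mul_lt_top (volume_unitBall_rpow_ne_top _).lt_top
    (lt_of_le_of_lt (iSup₂_le fun t ht => ?_) hL1.lt_top)
  have hT0 : ENNReal.ofReal (t ^ (n * (s - 1) / p)) ≠ 0 := by simp; positivity
  have hT1 : ENNReal.ofReal (t ^ (n * (s - 1) / p)) ≠ ∞ := ENNReal.ofReal_ne_top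
  rw [mul_comm, ← ENNReal.le_div_iff_mul_le (Or.inl hT0) (Or.inl hT1)]
  refine sInf_le ⟨ENNReal.div_pos hL0 hT1, ENNReal.div_lt_top hL1 hT0, ?_⟩
  simpa only [ofReal_rpow_mul_div ht] using h t ht

end Luxemburg

/-! ### Finiteness of `dPrime` for the step exponent. -/

section StepExponent
variable {n : ℕ} {β s p : ℝ}

theorem stepExponent_of_lt {x : EuclideanSpace ℝ (Fin n)} (h : ‖x‖ < 1) : stepExponent n x = 1 :=
  if_pos h

theorem stepExponent_of_le {x : EuclideanSpace ℝ (Fin n)} (h : 1 ≤ ‖x‖) : stepExponent n x = 2 :=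
  if_neg (not_lt.2 h)

theorem stepExponent_pos (x : EuclideanSpace ℝ (Fin n)) : 0 < stepExponent n x := by
  unfold stepExponent; split_ifs <;> norm_num

theorem measurable_stepExponent : Measurable (stepExponent n) :=
  Measurable.ite (measurableSet_lt measurable_norm measurable_const) measurable_const
    measurable_const

/-- The two conditions on `β` say that the integrand is dominated by `‖x‖ ^ (-n - σ)` inside the
unit ball and by `‖x‖ ^ (-n - 2σ)` outside it. The tail integrals of these powers cancel the
prefactors `t ^ σ` and `t ^ (2σ)`, so the bound is uniform in `t`. -/
theorem dPrime_stepExponent_lt_top [NeZero n] (hp : 0 < p) (hs : 1 < s) (h1 : n * (1 / p - 1) ≤ β)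
    (h2 : β ≤ n * (1 / p - 1 / 2)) : dPrime (stepExponent n) β s p < ∞ := by
  have hn : (0 : ℝ) < n := Nat.cast_pos.2 (NeZero.pos n)
  have hs' : 0 < s - 1 := by linarith
  have hV := volume_real_unitBall_pos (n := n)
  set V := volume.real (Metric.ball (0 : EuclideanSpace ℝ (Fin n)) 1) with hVdef
  set σ := n * (s - 1) / p with hσdef
  have hσ : 0 < σ := by positivity
  set a := β - n * s / p with ha
  have ea : a + σ = β - n / p := by rw [ha, hσdef]; ring
  have ha1 : -n - σ ≤ a := by
    have : n * (1 / p - 1) = n / p - n := by ring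
    linarith
  have ha2 : 2 * a ≤ -n - 2 * σ := by
    have : n * (1 / p - 1 / 2) = n / p - n / 2 := by ring
    linarith
  set c := V * n / σ with hc
  have hc0 : 0 < c := by positivity
  -- Chosen so that the two contributions, `c / ℓ` and `c / (2 * ℓ ^ 2)`, are each at most `1 / 2`.
  set ℓ := 1 + 2 * c with hℓ
  have hℓ0 : 0 < ℓ := by positivity
  refine dPrime_lt_top_of_lintegral_tail_le_one (L := ENNReal.ofReal ℓ) (by simpa using hℓ0)
    ENNReal.ofReal_ne_top fun t ht => ?_
  have hpt : ∀ x ∈ {x : EuclideanSpace ℝ (Fin n) | t < ‖x‖},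
      (ENNReal.ofReal (t ^ σ * ‖x‖ ^ a) / ENNReal.ofReal ℓ) ^ stepExponent n x ≤
      ENNReal.ofReal (t ^ σ / ℓ) * ENNReal.ofReal (‖x‖ ^ (-n - σ)) +
      ENNReal.ofReal (t ^ (2 * σ) / ℓ ^ 2) * ENNReal.ofReal (‖x‖ ^ (-n - 2 * σ)) := by
    intro x hx
    have h0 : 0 < ‖x‖ := ht.trans hx
    rw [← ENNReal.ofReal_div_of_pos hℓ0, ENNReal.ofReal_rpow_of_pos (by positivity),
      ← ENNReal.ofReal_mul (by positivity), ← ENNReal.ofReal_mul (by positivity),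
      ← ENNReal.ofReal_add (by positivity) (by positivity)]
    refine ENNReal.ofReal_le_ofReal ?_
    rcases lt_or_ge ‖x‖ 1 with h | h
    · rw [stepExponent_of_lt h, Real.rpow_one]
      have := Real.rpow_le_rpow_of_exponent_ge h0 h.le ha1
      calc t ^ σ * ‖x‖ ^ a / ℓ = t ^ σ / ℓ * ‖x‖ ^ a := by ring
        _ ≤ t ^ σ / ℓ * ‖x‖ ^ (-n - σ) := by gcongr
        _ ≤ _ := le_add_of_nonneg_right (by positivity)
    · rw [stepExponent_of_le h]
      have := Real.rpow_le_rpow_of_exponent_le h ha2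
      calc (t ^ σ * ‖x‖ ^ a / ℓ) ^ (2 : ℝ) = t ^ (2 * σ) / ℓ ^ 2 * ‖x‖ ^ (2 * a) := by
            rw [mul_comm 2 σ, mul_comm 2 a, Real.rpow_mul ht.le, Real.rpow_mul h0.le]
            simp only [Real.rpow_two]
            ring
        _ ≤ t ^ (2 * σ) / ℓ ^ 2 * ‖x‖ ^ (-n - 2 * σ) := by gcongr
        _ ≤ _ := le_add_of_nonneg_left (by positivity)
  refine (setLIntegral_mono (by fun_prop) hpt).trans ?_
  rw [lintegral_add_left (by fun_prop), lintegral_const_mul _ (by fun_prop),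
    lintegral_const_mul _ (by fun_prop), lintegral_norm_rpow_tail ht hσ,
    lintegral_norm_rpow_tail ht (by positivity), ← hVdef, ← ENNReal.ofReal_mul (by positivity),
    ← ENNReal.ofReal_mul (by positivity), ← ENNReal.ofReal_add (by positivity) (by positivity),
    ← ENNReal.ofReal_one]
  refine ENNReal.ofReal_le_ofReal ?_
  have e1 : t ^ σ / ℓ * (V * (n * t ^ (-σ) / σ)) = c / ℓ := by
    rw [Real.rpow_neg ht.le]
    have : t ^ σ ≠ 0 := by positivity
    rw [hc]; field_simp
  have e2 : t ^ (2 * σ) / ℓ ^ 2 * (V * (n * t ^ (-(2 * σ)) / (2 * σ))) = c / (2 * ℓ ^ 2) := by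
    rw [Real.rpow_neg ht.le]
    have : t ^ (2 * σ) ≠ 0 := by positivity
    rw [hc]; field_simp
  rw [e1, e2]
  have b1 : c / ℓ ≤ 1 / 2 := by rw [div_le_div_iff₀ hℓ0 two_pos]; linarith
  have b2 : c / (2 * ℓ ^ 2) ≤ 1 / 2 := by
    rw [div_le_div_iff₀ (by positivity) two_pos]; nlinarith
  linarith

/-- On a dyadic annulus a power of the norm is comparable with the power of the radius. -/
theorem min_one_two_rpow_mul_le {t r a : ℝ} (ht : 0 < t) (h1 : t ≤ r) (h2 : r ≤ 2 * t) :
    min 1 (2 ^ a) * t ^ a ≤ r ^ a := by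
  have hr : 0 < r := ht.trans_le h1
  rcases le_total 0 a with ha | ha
  · calc min 1 (2 ^ a) * t ^ a ≤ 1 * t ^ a := by gcongr; exact min_le_left _ _
      _ ≤ r ^ a := by rw [one_mul]; exact Real.rpow_le_rpow ht.le h1 ha
  · calc min 1 (2 ^ a) * t ^ a ≤ 2 ^ a * t ^ a := by gcongr; exact min_le_right _ _
      _ = (2 * t) ^ a := (Real.mul_rpow two_pos.le ht.le).symm
      _ ≤ r ^ a := Real.rpow_le_rpow_of_nonpos hr h2 ha

theorem volume_annulus [NeZero n] {t : ℝ} (ht : 0 < t) :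
    volume (Metric.ball (0 : EuclideanSpace ℝ (Fin n)) (2 * t) \ Metric.closedBall 0 t) =
      ENNReal.ofReal (volume.real (Metric.ball (0 : EuclideanSpace ℝ (Fin n)) 1) *
        ((2 ^ n - 1) * t ^ n)) := by
  have hsub : Metric.closedBall (0 : EuclideanSpace ℝ (Fin n)) t ⊆ Metric.ball 0 (2 * t) :=
    Metric.closedBall_subset_ball (by linarith)
  rw [← ENNReal.ofReal_toReal (((measure_mono Set.sdiff_subset).trans_lt
    (measure_ball_lt_top (x := (0 : EuclideanSpace ℝ (Fin n))) (r := 2 * t))).ne), ← measureReal_def,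
    measureReal_sdiff hsub measurableSet_closedBall, volume_real_ball (by positivity),
    measureReal_def _ (Metric.closedBall _ _), Measure.addHaar_closedBall_eq_addHaar_ball,
    ← measureReal_def, volume_real_ball ht]
  congr 1; ring

/-- On the annulus `t < ‖x‖ < 2t` the integrand is at least a constant times `t ^ (r(σ + a))`, and
the volume is a constant times `t ^ n`. The right side is free of `t`, so letting `t` tend to `0` or
`∞` constrains the sign of the exponent. -/
theorem exponent_bound_of_annulus [NeZero n] {q : EuclideanSpace ℝ (Fin n) → ℝ} {σ a ℓ r t : ℝ}
    (hℓ : 0 < ℓ) (hr : 0 < r) (ht : 0 < t)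
    (hq : ∀ x : EuclideanSpace ℝ (Fin n), t < ‖x‖ → ‖x‖ < 2 * t → q x = r)
    (h : ∫⁻ x in {x : EuclideanSpace ℝ (Fin n) | t < ‖x‖},
      (ENNReal.ofReal (t ^ σ * ‖x‖ ^ a) / ENNReal.ofReal ℓ) ^ q x ≤ 1) :
    t ^ (r * (σ + a) + n) ≤
      ((min 1 (2 ^ a) / ℓ) ^ r * (volume.real (Metric.ball (0 : EuclideanSpace ℝ (Fin n)) 1) *
        (2 ^ n - 1)))⁻¹ := by
  have hV := volume_real_unitBall_pos (n := n)
  set V := volume.real (Metric.ball (0 : EuclideanSpace ℝ (Fin n)) 1) with hVdef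
  have h2n : (0 : ℝ) < 2 ^ n - 1 := by
    have := one_lt_pow₀ (one_lt_two (α := ℝ)) (NeZero.ne n)
    linarith
  set m : ℝ := min 1 (2 ^ a) with hm
  have hm0 : 0 < m := by positivity
  set A := Metric.ball (0 : EuclideanSpace ℝ (Fin n)) (2 * t) \ Metric.closedBall 0 t with hA
  have hAm : MeasurableSet A := measurableSet_ball.diff measurableSet_closedBall
  have hAmem : ∀ x ∈ A, t < ‖x‖ ∧ ‖x‖ < 2 * t := fun x hx => by
    simpa [hA, and_comm] using hx
  have hsub : A ⊆ {x : EuclideanSpace ℝ (Fin n) | t < ‖x‖} := fun x hx => (hAmem x hx).1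
  have h3 : ∫⁻ x in A, ENNReal.ofReal ((t ^ σ * (m * t ^ a) / ℓ) ^ r) ≤ 1 := by
    refine le_trans (setLIntegral_mono' hAm fun x hx => ?_) ((lintegral_mono_set hsub).trans h)
    obtain ⟨hx1, hx2⟩ := hAmem x hx
    have h0 : 0 < ‖x‖ := ht.trans hx1
    rw [hq x hx1 hx2, ← ENNReal.ofReal_div_of_pos hℓ, ENNReal.ofReal_rpow_of_pos (by positivity)]
    have := min_one_two_rpow_mul_le (a := a) ht hx1.le hx2.le
    refine ENNReal.ofReal_le_ofReal ?_
    gcongr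
  rw [setLIntegral_const, hA, volume_annulus ht, ← ENNReal.ofReal_mul (by positivity),
    ENNReal.ofReal_le_one] at h3
  rw [le_inv_comm₀ (by positivity) (by positivity), ← one_div, le_div_iff₀ (by positivity)]
  refine le_trans (le_of_eq ?_) h3
  rw [show t ^ σ * (m * t ^ a) / ℓ = (m / ℓ) * t ^ (σ + a) by rw [Real.rpow_add ht]; ring,
    Real.mul_rpow (by positivity) (by positivity), ← Real.rpow_mul ht.le, Real.rpow_add ht,
    Real.rpow_natCast, mul_comm r]
  ring

theorem bounds_of_dPrime_stepExponent_lt_top [NeZero n]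
    (h : dPrime (stepExponent n) β s p < ∞) :
    n * (1 / p - 1) ≤ β ∧ β ≤ n * (1 / p - 1 / 2) := by
  obtain ⟨D, hD1, hD2⟩ := exists_between h
  set L := volume (Metric.ball (0 : EuclideanSpace ℝ (Fin n)) 1) ^ (1 / p) * D with hL
  have hL1 : L ≠ ∞ := ENNReal.mul_ne_top (volume_unitBall_rpow_ne_top _) hD2.ne
  have hL0 : L ≠ 0 := mul_ne_zero (volume_unitBall_rpow_ne_zero _) (bot_le.trans_lt hD1).ne'
  have hℓ : 0 < L.toReal := ENNReal.toReal_pos hL0 hL1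
  have key := fun t (ht : 0 < t) => lintegral_tail_le_one_of_dPrime_lt (fun x => (stepExponent_pos x).le) hD1 ht
  rw [← hL, ← ENNReal.ofReal_toReal hL1] at key
  have e : n * (s - 1) / p + (β - n * s / p) = β - n / p := by ring
  constructor
  · by_contra! hlt
    have hexp : 1 * (n * (s - 1) / p + (β - n * s / p)) + n < 0 := by
      have : n * (1 / p - 1) = n / p - n := by ring
      rw [e]; linarith
    have hlim := tendsto_rpow_neg_nhdsGT_zero hexp
    -- With `t < 1 / 2` the annulus lies in the unit ball, where the exponent is `1`.
    obtain ⟨t, ht1, ht2, ht3⟩ := ((hlim.eventually_gt_atTop _).and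
      (Ioo_mem_nhdsGT (show (0 : ℝ) < 1 / 2 by norm_num))).exists
    exact (exponent_bound_of_annulus hℓ one_pos ht2
      (fun x _ hx => stepExponent_of_lt (by linarith)) (key t ht2)).not_gt ht1
  · by_contra! hlt
    have hexp : 0 < 2 * (n * (s - 1) / p + (β - n * s / p)) + n := by
      have : n * (1 / p - 1 / 2) = n / p - n / 2 := by ring
      rw [e]; linarith
    have hlim := tendsto_rpow_atTop hexp
    -- With `t ≥ 1` the annulus lies outside the unit ball, where the exponent is `2`.
    obtain ⟨t, ht1, ht2⟩ := ((Filter.eventually_ge_atTop 1).and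
      (hlim.eventually_gt_atTop _)).exists
    have ht0 : 0 < t := one_pos.trans_le ht1
    exact (exponent_bound_of_annulus hℓ two_pos ht0
      (fun x hx _ => stepExponent_of_le (ht1.trans hx.le)) (key t ht0)).not_gt ht2

theorem essInf_stepExponent [NeZero n] : essInf (stepExponent n) volume = 1 := by
  have hset : {a | volume {x | stepExponent n x < a} = 0} = Set.Iic 1 := by
    ext a
    simp only [Set.mem_ofPred_eq, Set.mem_Iic]
    refine ⟨fun h => ?_, fun h => ?_⟩
    · by_contra! ha
      refine (Metric.measure_ball_pos volume (0 : EuclideanSpace ℝ (Fin n)) one_pos).ne'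
        (measure_mono_null (fun x hx => ?_) h)
      have : ‖x‖ < 1 := by simpa using hx
      simpa [stepExponent_of_lt this] using ha
    · convert measure_empty (μ := (volume : Measure (EuclideanSpace ℝ (Fin n))))
      ext x
      simp only [Set.mem_ofPred_eq, Set.mem_empty_iff_false, iff_false, not_lt]
      unfold stepExponent; split_ifs <;> linarith
  rw [essInf_eq_sSup, hset, csSup_Iic]

theorem essSup_stepExponent [NeZero n] : essSup (stepExponent n) volume = 2 := by
  have hset : {a | volume {x | a < stepExponent n x} = 0} = Set.Ici 2 := by
    ext a
    simp only [Set.mem_ofPred_eq, Set.mem_Ici]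
    refine ⟨fun h => ?_, fun h => ?_⟩
    · by_contra! ha
      have hpos : volume (Metric.ball (0 : EuclideanSpace ℝ (Fin n)) (2 * 1) \
          Metric.closedBall 0 1) ≠ 0 := by
        have hV := volume_real_unitBall_pos (n := n)
        have := one_lt_pow₀ (one_lt_two (α := ℝ)) (NeZero.ne n)
        rw [volume_annulus one_pos, ne_eq, ENNReal.ofReal_eq_zero, not_le]
        have : (0 : ℝ) < 2 ^ n - 1 := by linarith
        positivity
      refine hpos (measure_mono_null (fun x hx => ?_) h)
      have : 1 < ‖x‖ := by simpa using hx.2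
      simpa [stepExponent_of_le this.le] using ha
    · convert measure_empty (μ := (volume : Measure (EuclideanSpace ℝ (Fin n))))
      ext x
      simp only [Set.mem_ofPred_eq, Set.mem_empty_iff_false, iff_false, not_lt]
      unfold stepExponent; split_ifs <;> linarith
  rw [essSup_eq_sInf, hset, csInf_Ici]

end StepExponent

/-! ### Jensen's inequality, for powers and for the geometric mean. -/

theorem lintegral_rpow_le_lintegral_rpow {α : Type*} [MeasurableSpace α] (μ : Measure α)
    [IsProbabilityMeasure μ] {h : α → ℝ≥0∞} (hh : AEMeasurable h μ) {r : ℝ} (hr : 1 ≤ r) :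
    (∫⁻ y, h y ∂μ) ^ r ≤ ∫⁻ y, h y ^ r ∂μ := by
  have hr0 : 0 < r := by linarith
  have key := eLpNorm'_le_eLpNorm'_of_exponent_le one_pos hr μ hh.aestronglyMeasurable
  simp only [eLpNorm', enorm_eq_self, ENNReal.rpow_one, div_one] at key
  rwa [one_div, ENNReal.le_rpow_inv_iff hr0] at key

section Jensen
variable {n : ℕ} {p s : ℝ} {f : EuclideanSpace ℝ (Fin n) → ℝ}

theorem integrable_of_lintegral_ofReal_ne_top {α : Type*} [MeasurableSpace α] {μ : Measure α}
    {u : α → ℝ} (hu : AEMeasurable u μ) (h1 : ∫⁻ y, ENNReal.ofReal (u y) ∂μ ≠ ∞)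
    (h2 : ∫⁻ y, ENNReal.ofReal (-u y) ∂μ ≠ ∞) : Integrable u μ := by
  refine ⟨hu.aestronglyMeasurable, ?_⟩
  calc ∫⁻ y, ‖u y‖ₑ ∂μ ≤ ∫⁻ y, (ENNReal.ofReal (u y) + ENNReal.ofReal (-u y)) ∂μ := by
        refine lintegral_mono fun y => ?_
        rcases le_total 0 (u y) with h | h
        · rw [Real.enorm_eq_ofReal h]; exact le_self_add
        · rw [← enorm_neg, Real.enorm_eq_ofReal (by linarith)]; exact le_add_self
    _ = ∫⁻ y, ENNReal.ofReal (u y) ∂μ + ∫⁻ y, ENNReal.ofReal (-u y) ∂μ :=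
        lintegral_add_left' hu.ennreal_ofReal _
    _ < ∞ := (ENNReal.add_ne_top.2 ⟨h1, h2⟩).lt_top

/-- Since `log u ≤ u ^ p / p`, the integral of `log f` can diverge only to `-∞`. -/
theorem lintegral_ofReal_log_lt_top (hp : 0 < p) (hf0 : ∀ x, 0 < f x)
    (hM : ∫⁻ x, ENNReal.ofReal (f x) ^ p ≠ ∞) (S : Set (EuclideanSpace ℝ (Fin n))) :
    ∫⁻ y in S, ENNReal.ofReal (Real.log (f y)) ≠ ∞ := by
  refine ne_top_of_le_ne_top (ENNReal.mul_ne_top (ENNReal.ofReal_ne_top (r := 1 / p)) hM) ?_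
  rw [← lintegral_const_mul' _ _ ENNReal.ofReal_ne_top]
  refine (setLIntegral_le_lintegral S _).trans (lintegral_mono fun y => ?_)
  rw [ENNReal.ofReal_rpow_of_pos (hf0 y), ← ENNReal.ofReal_mul (by positivity)]
  refine ENNReal.ofReal_le_ofReal ?_
  rw [one_div_mul_eq_div]
  exact Real.log_le_rpow_div (hf0 y).le hp

/-- Jensen's inequality for the geometric mean, with respect to the weight `‖y‖ ^ (n * (s - 1))`. -/
theorem geomMeanOp_rpow_le [NeZero n] (hp : 0 < p) (hs : 1 < s) (hf : AEMeasurable f volume)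
    (hf0 : ∀ x, 0 < f x) (hM : ∫⁻ x, ENNReal.ofReal (f x) ^ p ≠ ∞)
    {x : EuclideanSpace ℝ (Fin n)} (hx : x ≠ 0) :
    geomMeanOp f x ^ p ≤ ENNReal.ofReal (Real.exp (s - 1) *
        (volume.real (Metric.ball (0 : EuclideanSpace ℝ (Fin n)) 1))⁻¹ * ‖x‖ ^ (-(n * s))) *
      ∫⁻ y in Metric.ball 0 ‖x‖, ENNReal.ofReal (f y) ^ p * ENNReal.ofReal (‖y‖ ^ (n * (s - 1))) := by
  have hR : 0 < ‖x‖ := norm_pos_iff.2 hx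
  have hV := volume_real_unitBall_pos (n := n)
  have hn : (0 : ℝ) < n := Nat.cast_pos.2 (NeZero.pos n)
  have hs' : 0 < s - 1 := by linarith
  set B := Metric.ball (0 : EuclideanSpace ℝ (Fin n)) ‖x‖ with hB
  have hlog : AEMeasurable (fun y => Real.log (f y)) (volume.restrict B) :=
    (Real.measurable_log.comp_aemeasurable hf).restrict
  have hP := lintegral_ofReal_log_lt_top hp hf0 hM B
  -- If the negative part diverges, the geometric mean is `0` and there is nothing to prove.
  by_cases hN : ∫⁻ y in B, ENNReal.ofReal (-Real.log (f y)) = ∞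
  · have hbot : logIntegral f B = ⊥ := by
      rw [logIntegral, hN, EReal.coe_ennreal_top, EReal.sub_top]
    have : geomMeanOp f x = 0 := by
      rw [geomMeanOp, ← hB, hbot, EReal.bot_div_of_pos_ne_top, EReal.exp_bot]
      · exact EReal.coe_ennreal_pos.2 (Metric.measure_ball_pos _ _ hR)
      · rw [ne_eq, EReal.coe_ennreal_eq_top_iff]
        exact measure_ball_lt_top.ne
    rw [this, ENNReal.zero_rpow_of_pos hp]
    exact zero_le
  have hint : IntegrableOn (fun y => Real.log (f y)) B :=
    integrable_of_lintegral_ofReal_ne_top hlog hP hN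
  set κ := n * (s - 1) with hκ
  have hκ0 : 0 < κ := by positivity
  set u : EuclideanSpace ℝ (Fin n) → ℝ := fun y => p * Real.log (f y) + κ * Real.log ‖y‖ with hu
  have hu1 : IntegrableOn (fun y => p * Real.log (f y)) B := hint.const_mul p
  have hu2 : IntegrableOn (fun y : EuclideanSpace ℝ (Fin n) => κ * Real.log ‖y‖) B :=
    (integrableOn_log_norm_ball hR).const_mul κ
  have huint : IntegrableOn u B := hu1.add hu2
  have hexp : ∀ᵐ y ∂(volume.restrict B), ENNReal.ofReal (Real.exp (u y)) =
      ENNReal.ofReal (f y) ^ p * ENNReal.ofReal (‖y‖ ^ κ) := by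
    have h0 : ∀ᵐ y ∂(volume : Measure (EuclideanSpace ℝ (Fin n))), y ≠ 0 :=
      Measure.ae_ne volume 0
    filter_upwards [ae_restrict_of_ae h0] with y hy
    have hy0 : 0 < ‖y‖ := norm_pos_iff.2 hy
    rw [ENNReal.ofReal_rpow_of_pos (hf0 y), ← ENNReal.ofReal_mul (by have := hf0 y; positivity),
      hu, Real.exp_add, Real.rpow_def_of_pos (hf0 y), Real.rpow_def_of_pos hy0, mul_comm p,
      mul_comm κ]
  have hfin : ∫⁻ y in B, ENNReal.ofReal (Real.exp (u y)) ≠ ∞ := by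
    rw [lintegral_congr_ae hexp]
    refine ne_top_of_le_ne_top
      (ENNReal.mul_ne_top hM (ENNReal.ofReal_ne_top (r := ‖x‖ ^ κ))) ?_
    rw [← lintegral_mul_const' _ _ ENNReal.ofReal_ne_top]
    refine (setLIntegral_mono' measurableSet_ball fun y hy => ?_).trans
      (setLIntegral_le_lintegral B _)
    have hy' : ‖y‖ ≤ ‖x‖ := by simpa using (Metric.mem_ball.1 hy).le
    gcongr
  have hexpm : AEMeasurable (fun y => Real.exp (u y)) (volume.restrict B) :=
    Real.measurable_exp.comp_aemeasurable huint.aemeasurable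
  have hexpint : IntegrableOn (fun y => Real.exp (u y)) B := by
    refine integrable_of_lintegral_ofReal_ne_top hexpm hfin ?_
    simp [ENNReal.ofReal_of_nonpos, Real.exp_nonneg]
  have jensen := convexOn_exp.map_set_average_le (μ := volume) (t := B) (f := u)
    Real.continuous_exp.continuousOn isClosed_univ (Metric.measure_ball_pos _ _ hR).ne'
    measure_ball_lt_top.ne (by simp) huint hexpint
  rw [setAverage_eq, setAverage_eq, hB, volume_real_ball hR, ← hB] at jensen
  have hIu : ∫ y in B, u y = p * (∫ y in B, Real.log (f y)) +
      κ * (volume.real (Metric.ball (0 : EuclideanSpace ℝ (Fin n)) 1) *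
        (‖x‖ ^ n * (Real.log ‖x‖ - 1 / n))) := by
    rw [hu, integral_add hu1 hu2, integral_const_mul, integral_const_mul, hB,
      setIntegral_log_norm_ball hR]
  rw [geomMeanOp_eq_ofReal_exp hint, ← lintegral_congr_ae hexp,
    ← ofReal_integral_eq_lintegral_ofReal hexpint (Filter.Eventually.of_forall fun y => (Real.exp_pos _).le),
    ENNReal.ofReal_rpow_of_pos (Real.exp_pos _), ← ENNReal.ofReal_mul (by positivity)]
  refine ENNReal.ofReal_le_ofReal ?_
  -- The weight adds `κ * (log ‖x‖ - 1 / n)` to the mean of `p * log f`; removing it costs `‖x‖ ^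
  -- (-κ) * e ^ (s - 1)`, as `κ / n = s - 1`.
  have hsplit : Real.exp ((∫ y in B, Real.log (f y)) / volume.real B) ^ p =
      Real.exp (s - 1) * ‖x‖ ^ (-κ) * Real.exp
        ((volume.real (Metric.ball (0 : EuclideanSpace ℝ (Fin n)) 1) * ‖x‖ ^ n)⁻¹ • ∫ y in B, u y) := by
    rw [hIu, hB, volume_real_ball hR, Real.rpow_def_of_pos hR, ← Real.exp_mul, ← Real.exp_add,
      ← Real.exp_add]
    congr 1
    simp only [smul_eq_mul, hκ]
    have : ‖x‖ ^ n ≠ 0 := by positivity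
    field_simp
    ring
  rw [hsplit]
  refine (mul_le_mul_of_nonneg_left jensen (by positivity)).trans (le_of_eq ?_)
  rw [show -(n * s) = -κ + -(n : ℝ) by rw [hκ]; ring, Real.rpow_add hR, Real.rpow_neg hR.le n,
    Real.rpow_natCast, mul_inv, smul_eq_mul]
  ring

end Jensen

/-! ### The upper bound for a general exponent `q ≥ p`. -/

section UpperBound
variable {n : ℕ} {p s β : ℝ} {q : EuclideanSpace ℝ (Fin n) → ℝ}

theorem lintegral_ofReal_rpow_ne_zero {f : EuclideanSpace ℝ (Fin n) → ℝ}
    (hf : AEMeasurable f volume) (hf0 : ∀ x, 0 < f x) :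
    ∫⁻ x, ENNReal.ofReal (f x) ^ p ≠ 0 := by
  intro h
  rw [lintegral_eq_zero_iff' (hf.ennreal_ofReal.pow_const p)] at h
  obtain ⟨x, hx⟩ := h.exists
  have hx' : ENNReal.ofReal (f x) ^ p = 0 := hx
  rw [ENNReal.ofReal_rpow_of_pos (hf0 x), ENNReal.ofReal_eq_zero] at hx'
  exact absurd (Real.rpow_pos_of_pos (hf0 x) p) (not_lt.2 hx')

theorem geomMeanInequality_of_dPrime_lt [NeZero n] (hp : 0 < p) (hs : 1 < s) (hq : Measurable q)
    (hpq : ∀ x, p ≤ q x) {d : ℝ} (h : dPrime q β s p < ENNReal.ofReal d) :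
    GeomMeanInequality q p β (Real.toNNReal (Real.exp ((s - 1) / p) * d)) := by
  intro f hf hf0
  have hd : 0 < d := by
    by_contra! hd
    simp [ENNReal.ofReal_of_nonpos hd] at h
  have hn : (0 : ℝ) < n := Nat.cast_pos.2 (NeZero.pos n)
  have hs' : 0 < s - 1 := by linarith
  set M := ∫⁻ x, ENNReal.ofReal (f x) ^ p with hM
  have hM0 : M ≠ 0 := lintegral_ofReal_rpow_ne_zero hf hf0
  have hc : 0 < Real.exp ((s - 1) / p) * d := by positivity
  change _ ≤ ENNReal.ofReal (Real.exp ((s - 1) / p) * d) * M ^ (1 / p)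
  have hc0 : ENNReal.ofReal (Real.exp ((s - 1) / p) * d) ≠ 0 := by simpa using hc
  by_cases hM1 : M = ∞
  · rw [hM1, ENNReal.top_rpow_of_pos (by positivity), ENNReal.mul_top hc0]
    exact le_top
  set Λ := ENNReal.ofReal (Real.exp ((s - 1) / p) * d) * M ^ (1 / p) with hΛ
  have hΛ0 : Λ ≠ 0 := mul_ne_zero hc0 (by simp [hM0, hM1])
  have hΛ1 : Λ ≠ ∞ := ENNReal.mul_ne_top ENNReal.ofReal_ne_top
    (ENNReal.rpow_ne_top_of_nonneg (by positivity) hM1)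
  refine sInf_le ⟨pos_iff_ne_zero.2 hΛ0, hΛ1.lt_top, ?_⟩
  have hV := volume_real_unitBall_pos (n := n)
  set V := volume.real (Metric.ball (0 : EuclideanSpace ℝ (Fin n)) 1) with hVdef
  set σ := n * (s - 1) / p with hσ
  have hσ0 : 0 < σ := by positivity
  set a := β - n * s / p with ha
  have htail : ∀ t : ℝ, 0 < t → ∫⁻ x in {x : EuclideanSpace ℝ (Fin n) | t < ‖x‖},
      ENNReal.ofReal (t ^ σ * ‖x‖ ^ a / (V ^ (1 / p) * d)) ^ q x ≤ 1 := by
    intro t ht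
    have := lintegral_tail_le_one_of_dPrime_lt (fun x => hp.le.trans (hpq x)) h ht
    rw [volume_unitBall_eq_ofReal, ENNReal.ofReal_rpow_of_pos hV,
      ← ENNReal.ofReal_mul (by positivity)] at this
    simpa only [← ENNReal.ofReal_div_of_pos (show 0 < V ^ (1 / p) * d by positivity)] using this
  have hg : AEMeasurable (fun y => ENNReal.ofReal (f y) ^ p) volume :=
    hf.ennreal_ofReal.pow_const p
  -- Total mass one lets Jensen's inequality do the work of a Minkowski inequality in variable
  -- exponent spaces, with no loss of constant.
  set ν : Measure (EuclideanSpace ℝ (Fin n)) :=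
    M⁻¹ • volume.withDensity (fun y => ENNReal.ofReal (f y) ^ p) with hν
  have hν1 : IsProbabilityMeasure ν := ⟨by
    rw [hν, Measure.smul_apply, withDensity_apply _ .univ, Measure.restrict_univ, smul_eq_mul,
      ← hM, ENNReal.inv_mul_cancel hM0 hM1]⟩
  -- For fixed `y`, this kernel is the integrand of the tail modular with `t = ‖y‖`; for fixed `x`,
  -- its `p`-th power is the normalised Hardy kernel of `geomMeanOp_rpow_le`.
  set H : EuclideanSpace ℝ (Fin n) → EuclideanSpace ℝ (Fin n) → ℝ≥0∞ := fun x y =>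
    if ‖y‖ < ‖x‖ then ENNReal.ofReal (‖y‖ ^ σ * ‖x‖ ^ a / (V ^ (1 / p) * d)) else 0 with hH
  have hHm : Measurable (Function.uncurry H) := by
    refine Measurable.ite (measurableSet_lt (by fun_prop) (by fun_prop)) ?_ measurable_const
    fun_prop
  have hHx : ∀ x, Measurable (H x) := fun x => hHm.of_uncurry_left
  have hmean : ∀ x : EuclideanSpace ℝ (Fin n), x ≠ 0 →
      (geomMeanOp f x * ENNReal.ofReal (‖x‖ ^ β) / Λ) ^ p ≤ ∫⁻ y, H x y ^ p ∂ν := by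
    intro x hx
    have hR : 0 < ‖x‖ := norm_pos_iff.2 hx
    have hlhs := geomMeanOp_rpow_le hp hs hf hf0 hM1 hx
    set J := ∫⁻ y in Metric.ball 0 ‖x‖,
      ENNReal.ofReal (f y) ^ p * ENNReal.ofReal (‖y‖ ^ (n * (s - 1))) with hJ
    have hrhs : ∫⁻ y, H x y ^ p ∂ν = ENNReal.ofReal (‖x‖ ^ (a * p) * (V * d ^ p)⁻¹) * M⁻¹ * J := by
      rw [hν, lintegral_smul_measure,
        lintegral_withDensity_eq_lintegral_mul₀ hg ((hHx x).pow_const p).aemeasurable, hJ,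
        smul_eq_mul, mul_right_comm, mul_comm, ← lintegral_const_mul' _ _ ENNReal.ofReal_ne_top,
        ← lintegral_indicator measurableSet_ball]
      congr 1
      refine lintegral_congr fun y => ?_
      simp only [Pi.mul_apply, hH, Set.indicator, Metric.mem_ball, dist_zero_right]
      split_ifs with hy
      · have hpow : ENNReal.ofReal (‖y‖ ^ σ * ‖x‖ ^ a / (V ^ (1 / p) * d)) ^ p =
            ENNReal.ofReal (‖x‖ ^ (a * p) * (V * d ^ p)⁻¹) *
              ENNReal.ofReal (‖y‖ ^ (n * (s - 1))) := by
          rw [ENNReal.ofReal_rpow_of_nonneg (by positivity) hp.le,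
            ← ENNReal.ofReal_mul (by positivity), Real.div_rpow (by positivity) (by positivity),
            Real.mul_rpow (by positivity) (by positivity),
            Real.mul_rpow (by positivity) (by positivity),
            ← Real.rpow_mul (norm_nonneg y), ← Real.rpow_mul hR.le, ← Real.rpow_mul hV.le,
            one_div_mul_cancel hp.ne', Real.rpow_one, hσ, div_mul_cancel₀ _ hp.ne']
          congr 1
          ring
        rw [hpow, mul_left_comm]
      · rw [ENNReal.zero_rpow_of_pos hp, mul_zero]
    have hΛp : Λ ^ p = ENNReal.ofReal (Real.exp (s - 1) * d ^ p) * M := by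
      rw [hΛ, ENNReal.mul_rpow_of_nonneg _ _ hp.le, ← ENNReal.rpow_mul,
        one_div_mul_cancel hp.ne', ENNReal.rpow_one,
        ENNReal.ofReal_rpow_of_pos hc, Real.mul_rpow (by positivity) hd.le, ← Real.exp_mul,
        div_mul_cancel₀ _ hp.ne']
    rw [hrhs, ENNReal.div_rpow_of_nonneg _ _ hp.le, ENNReal.mul_rpow_of_nonneg _ _ hp.le, hΛp,
      ENNReal.ofReal_rpow_of_pos (by positivity), ENNReal.div_eq_inv_mul,
      ENNReal.mul_inv (Or.inr hM1) (Or.inr hM0), ← ENNReal.ofReal_inv_of_pos (by positivity)]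
    refine (mul_le_mul_right (mul_le_mul_left hlhs _) _).trans (le_of_eq ?_)
    have hconst : ENNReal.ofReal (‖x‖ ^ (a * p) * (V * d ^ p)⁻¹) =
        ENNReal.ofReal (Real.exp (s - 1) * d ^ p)⁻¹ *
          (ENNReal.ofReal (Real.exp (s - 1) * V⁻¹ * ‖x‖ ^ (-(n * s))) *
            ENNReal.ofReal ((‖x‖ ^ β) ^ p)) := by
      rw [← ENNReal.ofReal_mul (by positivity), ← ENNReal.ofReal_mul (by positivity),
        show a * p = -(n * s) + β * p by rw [ha]; field_simp; ring, Real.rpow_add hR,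
        ← Real.rpow_mul hR.le]
      congr 1
      field_simp
    rw [hconst, ← hVdef]
    ring
  have hpt : ∀ᵐ x ∂(volume : Measure (EuclideanSpace ℝ (Fin n))),
      (geomMeanOp f x * ENNReal.ofReal (‖x‖ ^ β) / Λ) ^ q x ≤ ∫⁻ y, H x y ^ q x ∂ν := by
    filter_upwards [Measure.ae_ne volume 0] with x hx
    have hr : 1 ≤ q x / p := (one_le_div hp).2 (hpq x)
    have e : q x = p * (q x / p) := by field_simp
    calc (geomMeanOp f x * ENNReal.ofReal (‖x‖ ^ β) / Λ) ^ q x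
        = ((geomMeanOp f x * ENNReal.ofReal (‖x‖ ^ β) / Λ) ^ p) ^ (q x / p) := by
          rw [← ENNReal.rpow_mul, ← e]
      _ ≤ (∫⁻ y, H x y ^ p ∂ν) ^ (q x / p) :=
          ENNReal.rpow_le_rpow (hmean x hx) (by linarith)
      _ ≤ ∫⁻ y, (H x y ^ p) ^ (q x / p) ∂ν :=
          lintegral_rpow_le_lintegral_rpow ν ((hHx x).pow_const p).aemeasurable hr
      _ = ∫⁻ y, H x y ^ q x ∂ν := by simp_rw [← ENNReal.rpow_mul, ← e]
  rw [Measure.restrict_univ]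
  refine (lintegral_mono_ae hpt).trans ?_
  rw [lintegral_lintegral_swap (by
    exact (hHm.pow (hq.comp measurable_fst)).aemeasurable)]
  refine (lintegral_mono (g := fun _ => 1) fun y => ?_).trans (by simp)
  have hind : ∀ x, H x y ^ q x = {x : EuclideanSpace ℝ (Fin n) | ‖y‖ < ‖x‖}.indicator
      (fun x => ENNReal.ofReal (‖y‖ ^ σ * ‖x‖ ^ a / (V ^ (1 / p) * d)) ^ q x) x := by
    intro x
    by_cases hxy : ‖y‖ < ‖x‖
    · simp [hH, Set.indicator, hxy]
    · simp [hH, Set.indicator, hxy, ENNReal.zero_rpow_of_pos (hp.trans_le (hpq x))]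
  simp only [hind]
  rw [lintegral_indicator (measurableSet_lt_norm _)]
  -- The tail bound needs `t > 0`; at `y = 0` the kernel vanishes because `σ > 0`.
  rcases (norm_nonneg y).eq_or_lt with hy | hy
  · simp [← hy, Real.zero_rpow hσ0.ne', ENNReal.zero_rpow_of_pos (hp.trans_le (hpq _))]
  · exact htail _ hy

end UpperBound

/-! ### The best constant and the final statement. -/

section BestConstant
variable {n : ℕ} {p s β : ℝ} {q : EuclideanSpace ℝ (Fin n) → ℝ}

theorem bestGeomMeanConstant_le [NeZero n] (hp : 0 < p) (hs : 1 < s) (hq : Measurable q)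
    (hpq : ∀ x, p ≤ q x) :
    bestGeomMeanConstant q p β ≤ ENNReal.ofReal (Real.exp ((s - 1) / p)) * dPrime q β s p := by
  have hexp := Real.exp_pos ((s - 1) / p)
  have he0 : ENNReal.ofReal (Real.exp ((s - 1) / p)) ≠ 0 := by simpa using hexp
  rw [mul_comm, ← ENNReal.div_le_iff_le_mul (Or.inl he0) (Or.inl ENNReal.ofReal_ne_top)]
  refine le_of_forall_gt_imp_ge_of_dense fun D hD => ?_
  rcases eq_or_ne D ∞ with rfl | hD1
  · exact le_top
  rw [ENNReal.div_le_iff_le_mul (Or.inl he0) (Or.inl ENNReal.ofReal_ne_top), mul_comm,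
    ← ENNReal.ofReal_toReal hD1, ← ENNReal.ofReal_mul hexp.le]
  rw [← ENNReal.ofReal_toReal hD1] at hD
  exact iInf₂_le _ (geomMeanInequality_of_dPrime_lt hp hs hq hpq hD)

/-- The base equals `1 + p / 2`. -/
theorem one_le_rpow_step_constant (hp : 0 < p) :
    1 ≤ ENNReal.ofReal ((p / 1 + (2 - p) / 2) ^ (2 / p)) := by
  rw [ENNReal.one_le_ofReal]
  exact Real.one_le_rpow (by linarith) (by positivity)

end BestConstant

theorem corollary2 (n : ℕ) (hn : 1 ≤ n) (p β : ℝ) (hp : 0 < p)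
    (hpq : ∀ x : EuclideanSpace ℝ (Fin n), p ≤ stepExponent n x) :
    ((∃ C : ℝ≥0, GeomMeanInequality (stepExponent n) p β C) ↔
      ∃ s ∈ Set.Icc 1 (1 + p / 2), n * (s / p - 1) ≤ β ∧ β ≤ n * (1 / p - 1 / 2)) ∧
    ((∃ C : ℝ≥0, GeomMeanInequality (stepExponent n) p β C) →
      (∀ s ∈ Set.Ioc 1 (1 + p / 2), dPrime (stepExponent n) β s p < ∞) ∧
      (⨆ s ∈ Set.Ioc 1 (1 + p / 2),
        ENNReal.ofReal (Real.exp (s / p) / (Real.exp s + 1 / (s - 1)) ^ (1 / p)) *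
          dPrime (stepExponent n) β s p) ≤ bestGeomMeanConstant (stepExponent n) p β ∧
      bestGeomMeanConstant (stepExponent n) p β ≤
        ENNReal.ofReal ((p / essInf (stepExponent n) volume +
            (essSup (stepExponent n) volume - p) / essSup (stepExponent n) volume) ^ (2 / p)) *
          ⨅ s ∈ Set.Ioc 1 (1 + p / 2),
            ENNReal.ofReal (Real.exp ((s - 1) / p)) * dPrime (stepExponent n) β s p) := by
  have : NeZero n := ⟨by omega⟩
  have hs : 1 < 1 + p / 2 := by linarith
  refine ⟨⟨fun ⟨C, hC⟩ => ?_, fun ⟨s, ⟨hs1, _⟩, hβ1, hβ2⟩ => ?_⟩, fun ⟨C, hC⟩ => ⟨?_, ?_, ?_⟩⟩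
  -- The lower condition on `β` is weakest at `s = 1`, so the existential over `s` amounts to that
  -- case; `dPrime` itself is used at `1 + p / 2`, since it needs `s > 1`.
  · exact ⟨1, ⟨le_rfl, hs.le⟩, bounds_of_dPrime_stepExponent_lt_top (hC.dPrime_lt_top hp hs)⟩
  · have h1 : n * (1 / p - 1) ≤ β := le_trans (by gcongr) hβ1
    obtain ⟨D, hD1, hD2⟩ := exists_between (dPrime_stepExponent_lt_top hp hs h1 hβ2)
    rw [← ENNReal.ofReal_toReal hD2.ne] at hD1
    exact ⟨_, geomMeanInequality_of_dPrime_lt hp hs measurable_stepExponent hpq hD1⟩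
  · exact fun s hs => hC.dPrime_lt_top hp hs.1
  · exact iSup₂_le fun s hs => le_iInf₂ fun C hC => hC.mul_dPrime_le hp hs.1
  · rw [essInf_stepExponent, essSup_stepExponent]
    refine le_trans (le_iInf₂ fun s hs => ?_) (le_mul_of_one_le_left' (one_le_rpow_step_constant hp))
    exact bestGeomMeanConstant_le hp hs.1 measurable_stepExponent hpq
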